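/- Let $G=(V,E,\omega)$ be a finite simple undirected graph with edge weights $\omega:E\to[0,\infty]$, together with a planar embedding: vertices are distinct points of $\mathbb R^2$, each edge is a simple arc joining its ends, an arc contains no vertex other than its ends, and two distinct arcs meet only in common ends. The faces are the connected components of the complement in $\mathbb R^2$ of the union of all vertices and arcs. Let $\mathrm{dist}(x,y)$ be the minimum weight of a walk from $x$ to $y$ ($\infty$ if there is none), and fix a linear order on $V$. For $x,v,v'\in V$, call $v$ closer to $x$ than $v'$ if $\mathrm{dist}(x,v)<\mathrm{dist}(x,v')$, or $\mathrm{dist}(x,v)=\mathrm{dist}(x,v')$ and $v<v'$. Let $\emptyset\ne S\subseteq V$, and let $p=p_1,\dots,p_k$ be a shortest path of $G$ of finite weight (a path with no repeated vertex whose weight is $\mathrm{dist}(p_1,p_k)<\infty$), all of whose vertices and arcs lie in the boundary of one face. Let $M(i)\in S$ be the vertex of $S$ closest to $p_i$, for $1\le i\le k$. The contraction of $M(1),\dots,M(k)$ is obtained by replacing each maximal block of equal consecutive symbols by a single occurrence of that symbol. Then the contraction of $M$ is an $(|S|,2)$-Davenport–Schinzel sequence over the alphabet $S$: any two consecutive symbols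 are different, and there are no indices $i_1<i_2<i_3<i_4$ and distinct symbols $u\ne v$ such that the symbols at positions $i_1,i_3$ are both $u$ and the symbols at positions $i_2,i_4$ are both $v$. -/

import Mathlib

open scoped ENNReal

/-- The plane with its Euclidean topology. -/
abbrev Plane : Type := EuclideanSpace ℝ (Fin 2)

/-- `A` is a simple arc in the plane with endpoints `x` and `y`. -/
def IsSimpleArc (A : Set Plane) (x y : Plane) : Prop :=
  ∃ γ : Path x y, Function.Injective γ ∧ Set.range γ = A

/-- A planar embedding of a graph: vertices are distinct points of the plane, edges are simple arcs
joining the points of their ends, an arc passes through no point of another vertex, and two arcs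
meet only in points of common ends. Only the values of `arc` on edges of `G` are ever used. -/
structure PlanarEmbedding {V : Type*} (G : SimpleGraph V) where
  pos : V → Plane
  arc : Sym2 V → Set Plane
  pos_injective : Function.Injective pos
  isSimpleArc : ∀ u v : V, G.Adj u v → IsSimpleArc (arc s(u, v)) (pos u) (pos v)
  mem_of_pos_mem_arc : ∀ e ∈ G.edgeSet, ∀ w : V, pos w ∈ arc e → w ∈ e
  arc_inter : ∀ e ∈ G.edgeSet, ∀ e' ∈ G.edgeSet, e ≠ e' →
    ∀ x ∈ arc e ∩ arc e', ∃ w : V, w ∈ e ∧ w ∈ e' ∧ x = pos w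

namespace PlanarEmbedding

variable {V : Type*} {G : SimpleGraph V}

/-- The point set of the drawing. -/
def drawing (D : PlanarEmbedding G) : Set Plane :=
  Set.range D.pos ∪ ⋃ e ∈ G.edgeSet, D.arc e

/-- The faces are the connected components of the complement of the drawing. -/
def IsFace (D : PlanarEmbedding G) (F : Set Plane) : Prop :=
  ∃ x ∈ D.drawingᶜ, F = connectedComponentIn D.drawingᶜ x

/-- All vertices and all edges of the walk `p`, as drawn, lie in the boundary of `F`. -/
def WalkOnBoundary (D : PlanarEmbedding G) {a b : V} (p : G.Walk a b) (F : Set Plane) : Prop :=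
  (∀ v ∈ p.support, D.pos v ∈ frontier F) ∧ (∀ e ∈ p.edges, D.arc e ⊆ frontier F)

end PlanarEmbedding

/-- The total weight of a walk; only the values of `ω` on edges of `G` are ever used. -/
noncomputable def walkWeight {V : Type*} {G : SimpleGraph V} (ω : Sym2 V → ℝ≥0∞) {a b : V}
    (p : G.Walk a b) : ℝ≥0∞ :=
  (p.edges.map ω).sum

/-- The weighted distance; it is `∞` if there is no connecting walk of finite weight. -/
noncomputable def weightedDist {V : Type*} (G : SimpleGraph V) (ω : Sym2 V → ℝ≥0∞) (a b : V) :
    ℝ≥0∞ :=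
  ⨅ p : G.Walk a b, walkWeight ω p

/-- `p` is a (simple) path from `a` to `b` whose weight is the distance from `a` to `b`. -/
def IsShortestPath {V : Type*} {G : SimpleGraph V} (ω : Sym2 V → ℝ≥0∞) {a b : V}
    (p : G.Walk a b) : Prop :=
  p.IsPath ∧ walkWeight ω p = weightedDist G ω a b

/-- `v` is closer than `v'` to `x`: smaller distance, ties being broken by the vertex order. -/
def Closer {V : Type*} [LinearOrder V] (G : SimpleGraph V) (ω : Sym2 V → ℝ≥0∞) (x v v' : V) :
    Prop :=
  weightedDist G ω x v < weightedDist G ω x v' ∨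
    (weightedDist G ω x v = weightedDist G ω x v' ∧ v < v')

theorem exists_closest {V : Type*} [LinearOrder V] (G : SimpleGraph V) (ω : Sym2 V → ℝ≥0∞)
    (S : Finset V) (hS : S.Nonempty) (x : V) :
    ∃ s ∈ S, ∀ t ∈ S, t ≠ s → Closer G ω x s t := by
  obtain ⟨s, hs, hmin⟩ :=
    S.exists_min_image (fun s => toLex (weightedDist G ω x s, s)) hS
  refine ⟨s, hs, fun t ht hts => ?_⟩
  rcases (Prod.Lex.toLex_le_toLex).1 (hmin t ht) with h | ⟨h, h'⟩
  · exact Or.inl h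
  · exact Or.inr ⟨h, lt_of_le_of_ne h' (Ne.symm hts)⟩

/-- The vertex of `S` nearest to `x`. -/
noncomputable def nearest {V : Type*} [LinearOrder V] (G : SimpleGraph V) (ω : Sym2 V → ℝ≥0∞)
    (S : Finset V) (hS : S.Nonempty) (x : V) : V :=
  Classical.choose (exists_closest G ω S hS x)

theorem nearest_spec {V : Type*} [LinearOrder V] (G : SimpleGraph V) (ω : Sym2 V → ℝ≥0∞)
    (S : Finset V) (hS : S.Nonempty) (x : V) :
    nearest G ω S hS x ∈ S ∧
      ∀ t ∈ S, t ≠ nearest G ω S hS x → Closer G ω x (nearest G ω S hS x) t :=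
  Classical.choose_spec (exists_closest G ω S hS x)

/-- The label sequence of a sequence of vertices. -/
noncomputable def labelSequence {V : Type*} [LinearOrder V] (G : SimpleGraph V)
    (ω : Sym2 V → ℝ≥0∞) (S : Finset V) (hS : S.Nonempty) (p : List V) : List V :=
  p.map (nearest G ω S hS)

/-- The contraction of a sequence: every maximal block of equal symbols becomes one symbol. -/
def contraction {α : Type*} [DecidableEq α] (l : List α) : List α :=
  l.destutter (fun x y => x ≠ y)

/-- `l` is an `(n, s)`-Davenport–Schinzel sequence over the alphabet `A`: the alphabet has `n`
symbols, neighbouring symbols differ, and no two distinct symbols `u`, `v` alternate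
`u, v, u, v, …` along a (not necessarily contiguous) subsequence of length `s + 2`. -/
structure IsDavenportSchinzel {α : Type*} (A : Finset α) (n s : ℕ) (l : List α) : Prop where
  card_eq : A.card = n
  mem : ∀ x ∈ l, x ∈ A
  ne_next : ∀ (i : ℕ) (h : i + 1 < l.length), l[i] ≠ l[i + 1]
  no_alternation : ¬ ∃ (idx : Fin (s + 2) → Fin l.length) (u v : α), StrictMono idx ∧ u ≠ v ∧
    ∀ j : Fin (s + 2), l.get (idx j) = if Even j.val then u else v

/-!
If the labels alternated `u, v, u, v` along the path, the graph `K₃,₃` could be drawn in the plane.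

A shortest walk from a vertex to its nearest element `s` of `S` stays among the vertices whose
nearest element is `s` (`exists_walk_nearest_eq`), so the cells of `u` and `v` are disjoint and
connected. Each of the three steps of the alternation contains an edge `xz` of the path such that
`x` lies in the cell of `u`, and `z` is joined to `v` by a walk that avoids this cell
(`SimpleGraph.Walk.exists_connecting_edge`). These three edges are distinct and lie on the boundary
of the face. Their midpoints are joined to `u`, to `v`, and, through the face, to a point of the
face; curves that start at different points of these three and end at different midpoints are
disjoint (`PlanarEmbedding.IsFace.not_three_connecting_edges`). Curves with a common end may meet
elsewhere, so neither disjoint paths inside a cell nor accessible boundary points are required.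

That `K₃,₃` has no such drawing (`not_drawing_K33`) is shown by an angle count in place of the
Jordan curve theorem. If `γ` and `δ` are disjoint curves, then `γ s - δ t` has a continuous
logarithm on the square, so the windings of the two curves about each other's ends satisfy a linear
relation (`logIncrement_add_logIncrement`). Up to whole turns the windings are determined by the
positions of the vertices. Summing the relations over all pairs of disjoint edges, every number of
whole turns occurs twice, while the contributions of the positions add up to an odd number
(`parity_contradiction`).
-/

/-! ### Topological nonplanarity of `K₃,₃` -/

section Topology

open scoped unitInterval

/-- The change of the logarithm of `g` over the unit interval: `L 1 - L 0` for any continuous `L`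
with `exp ∘ L = g`. It does not depend on `L`; the value is `0` if there is no such `L`. -/
noncomputable def logIncrement (g : I → ℂ) : ℂ :=
  open Classical in
  if h : ∃ L : I → ℂ, Continuous L ∧ ∀ t, Complex.exp (L t) = g t then h.choose 1 - h.choose 0
  else 0

instance : ContractibleSpace I :=
  (convex_Icc (0 : ℝ) 1).contractibleSpace ⟨0, by simp⟩

instance : LocallyPathConnectedSpace I :=
  (convex_Icc (0 : ℝ) 1).locallyPathConnectedSpace

theorem exists_continuous_log {X : Type*} [TopologicalSpace X] [SimplyConnectedSpace X]
    [LocallyPathConnectedSpace X] {g : X → ℂ} (hg : Continuous g) (h0 : ∀ x, g x ≠ 0) :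
    ∃ L : X → ℂ, Continuous L ∧ ∀ x, Complex.exp (L x) = g x := by
  obtain ⟨x₀⟩ : Nonempty X := inferInstance
  obtain ⟨L, ⟨-, hL⟩, -⟩ := Complex.isCoveringMapOn_exp.existsUnique_continuousMap_lifts
    ⟨g, hg⟩ (a₀ := x₀) (Complex.exp_log (h0 x₀)) h0
  exact ⟨L, L.continuous, fun x => congrFun hL x⟩

/-- Continuous logarithms of two functions with constant quotient differ by a constant, by
uniqueness of lifts along the covering `exp`. -/
theorem log_sub_eq_of_exp_eq_mul {X : Type*} [TopologicalSpace X] [PreconnectedSpace X]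
    {L M : X → ℂ} (hL : Continuous L) (hM : Continuous M) {c : ℂ}
    (h : ∀ x, Complex.exp (L x) = c * Complex.exp (M x)) (x y : X) :
    L x - L y = M x - M y := by
  have key : L = fun z => M z + (L y - M y) := by
    refine Complex.isCoveringMap_exp.eq_of_comp_eq hL (by fun_prop) ?_ y (by ring)
    funext z
    apply Subtype.ext
    have hy := h y
    have : Complex.exp (L y - M y) = c := by
      rw [Complex.exp_sub, hy, mul_div_cancel_right₀ _ (Complex.exp_ne_zero _)]
    simp only [Function.comp_apply, Complex.exp_add, this, h z]
    ring
  have := congrFun key x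
  rw [this]; ring

/-- The constant factor `c` covers restrictions of a logarithm on the square to its edges, where the
function of interest appears up to sign. -/
theorem logIncrement_eq {g L : I → ℂ} {c : ℂ} (hc : c ≠ 0) (hL : Continuous L)
    (h : ∀ t, Complex.exp (L t) = c * g t) : logIncrement g = L 1 - L 0 := by
  have hex : ∃ L : I → ℂ, Continuous L ∧ ∀ t, Complex.exp (L t) = g t := by
    refine ⟨fun t => L t - Complex.log c, by fun_prop, fun t => ?_⟩
    rw [Complex.exp_sub, Complex.exp_log hc, h, mul_div_cancel_left₀ _ hc]
  rw [logIncrement, dif_pos hex]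
  refine (log_sub_eq_of_exp_eq_mul hL hex.choose_spec.1 (c := c) (fun t => ?_) 1 0).symm
  rw [h, hex.choose_spec.2]

theorem exp_logIncrement {g : I → ℂ} (hg : Continuous g) (h0 : ∀ t, g t ≠ 0) :
    Complex.exp (logIncrement g) = g 1 / g 0 := by
  obtain ⟨L, hL, hLg⟩ := exists_continuous_log hg h0
  rw [logIncrement_eq one_ne_zero hL (by simpa using hLg), Complex.exp_sub, hLg, hLg]

/-- For disjoint curves `γ` and `δ`, the function `γ s - δ t` has a continuous logarithm on the whole
square, whose total change along the boundary is zero. -/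
theorem logIncrement_add_logIncrement {γ δ : I → ℂ} (hγ : Continuous γ) (hδ : Continuous δ)
    (h : ∀ s t, γ s ≠ δ t) :
    logIncrement (fun s => γ s - δ 0) + logIncrement (fun t => δ t - γ 1) =
      logIncrement (fun t => δ t - γ 0) + logIncrement (fun s => γ s - δ 1) := by
  obtain ⟨L, hL, hLg⟩ := exists_continuous_log (g := fun z : I × I => γ z.1 - δ z.2)
    (by fun_prop) (fun z => sub_ne_zero.2 (h _ _))
  have h1 (t : I) : logIncrement (fun s => γ s - δ t) = L (1, t) - L (0, t) :=
    logIncrement_eq one_ne_zero (L := fun s => L (s, t)) (by fun_prop) (fun s => by simp [hLg])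
  have h2 (s : I) : logIncrement (fun t => δ t - γ s) = L (s, 1) - L (s, 0) :=
    logIncrement_eq (neg_ne_zero.2 one_ne_zero) (L := fun t => L (s, t)) (by fun_prop)
      (fun t => by simp [hLg])
  rw [h1, h1, h2, h2]
  ring

/-- Logarithms of the differences of distinct points, chosen so that exchanging the two points
changes the logarithm by exactly `π i`. -/
theorem exists_antisymmetric_log {ι : Type*} [LinearOrder ι] {P : ι → ℂ}
    (hP : Function.Injective P) :
    ∃ b : ι → ι → ℂ, (∀ i k, i ≠ k → Complex.exp (b i k) = P i - P k) ∧
      ∀ i k, i < k → b k i - b i k = Real.pi * Complex.I := by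
  refine ⟨fun i k => if i < k then Complex.log (P i - P k)
    else Complex.log (P k - P i) + Real.pi * Complex.I, fun i k hik => ?_, fun i k hik => ?_⟩
  · have h1 : P i - P k ≠ 0 := sub_ne_zero.2 (hP.ne hik)
    have h2 : P k - P i ≠ 0 := sub_ne_zero.2 (hP.ne hik.symm)
    dsimp only
    split_ifs
    · exact Complex.exp_log h1
    · rw [Complex.exp_add, Complex.exp_log h2, Complex.exp_pi_mul_I]; ring
  · simp [hik, hik.not_gt]

/-- The eighteen unordered pairs of disjoint edges of `K₃,₃` give eighteen equations. Every unknown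
occurs in two of them, so the right-hand sides have an even sum, while the left-hand sides add up
to nine. -/
theorem parity_contradiction (m n : Fin 3 → Fin 3 → Fin 3 → ℤ)
    (h1 : ∀ i i' j j', i < i' → j < j' → 1 = m i i' j' + n j' i j - m i' i j - n j i' j')
    (h0 : ∀ i i' j j', i < i' → j' < j → 0 = m i i' j' + n j' i j - m i' i j - n j i' j') :
    False := by
  have a1 := h1 0 1 0 1 (by decide) (by decide)
  have a2 := h1 0 1 0 2 (by decide) (by decide)
  have a3 := h1 0 1 1 2 (by decide) (by decide)
  have a4 := h1 0 2 0 1 (by decide) (by decide)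
  have a5 := h1 0 2 0 2 (by decide) (by decide)
  have a6 := h1 0 2 1 2 (by decide) (by decide)
  have a7 := h1 1 2 0 1 (by decide) (by decide)
  have a8 := h1 1 2 0 2 (by decide) (by decide)
  have a9 := h1 1 2 1 2 (by decide) (by decide)
  have b1 := h0 0 1 1 0 (by decide) (by decide)
  have b2 := h0 0 1 2 0 (by decide) (by decide)
  have b3 := h0 0 1 2 1 (by decide) (by decide)
  have b4 := h0 0 2 1 0 (by decide) (by decide)
  have b5 := h0 0 2 2 0 (by decide) (by decide)
  have b6 := h0 0 2 2 1 (by decide) (by decide)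
  have b7 := h0 1 2 1 0 (by decide) (by decide)
  have b8 := h0 1 2 2 0 (by decide) (by decide)
  have b9 := h0 1 2 2 1 (by decide) (by decide)
  omega

/-- Topological nonplanarity of `K₃,₃`, for drawings in which only pairs of edges without a common
end are required to be disjoint. -/
theorem not_drawing_K33_complex (P Q : Fin 3 → ℂ) (γ : ∀ i j, Path (P i) (Q j))
    (hγ : ∀ i i' j j', i ≠ i' → j ≠ j' → ∀ s t, γ i j s ≠ γ i' j' t) : False := by
  have hex (j : Fin 3) : ∃ l, l ≠ j := exists_ne j
  have hP : Function.Injective P := by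
    intro i k hik
    by_contra hne
    have := hγ i k 0 1 hne (by decide) 0 0
    simp [hik] at this
  have hQ : Function.Injective Q := by
    intro i k hik
    by_contra hne
    have := hγ 0 1 i k (by decide) hne 1 1
    simp [hik] at this
  have hPγ (k i j : Fin 3) (hki : k ≠ i) (t : I) : γ i j t - P k ≠ 0 := by
    obtain ⟨l, hl⟩ := hex j
    have := hγ i k j l hki.symm hl.symm t 0
    simpa [sub_eq_zero] using this
  have hQγ (l i j : Fin 3) (hlj : l ≠ j) (t : I) : γ i j t - Q l ≠ 0 := by
    obtain ⟨k, hk⟩ := hex i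
    have := hγ i k j l hk.symm hlj.symm t 1
    simpa [sub_eq_zero] using this
  have hPQ (i j : Fin 3) : P i - Q j ≠ 0 := by
    obtain ⟨l, hl⟩ := hex j
    obtain ⟨k, hk⟩ := hex i
    have := hγ i k l j hk.symm hl 0 1
    simpa [sub_eq_zero] using this
  obtain ⟨b, hb, hb'⟩ := exists_antisymmetric_log hP
  obtain ⟨c, hc, hc'⟩ := exists_antisymmetric_log hQ
  -- The winding of `γ i j` about a vertex is, up to an integer number of turns, a difference of the
  -- chosen logarithms; in the direction from `Q j` to `P k` the logarithm is shifted by `π i`.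
  have hm (k i j : Fin 3) : ∃ m : ℤ, k ≠ i → logIncrement (fun t => γ i j t - P k) =
      Complex.log (P k - Q j) + Real.pi * Complex.I - b i k + m * (2 * Real.pi * Complex.I) := by
    by_cases hki : k = i
    · exact ⟨0, fun h => absurd hki h⟩
    obtain ⟨m, hm⟩ := Complex.exp_eq_exp_iff_exists_int.1
      (show Complex.exp (logIncrement (fun t => γ i j t - P k)) =
        Complex.exp (Complex.log (P k - Q j) + Real.pi * Complex.I - b i k) by
        rw [exp_logIncrement (by fun_prop) (hPγ k i j hki), Complex.exp_sub, Complex.exp_add,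
          Complex.exp_log (hPQ k j), hb i k (Ne.symm hki), Complex.exp_pi_mul_I]
        simp)
    exact ⟨m, fun _ => hm⟩
  have hn (l i j : Fin 3) : ∃ n : ℤ, l ≠ j → logIncrement (fun t => γ i j t - Q l) =
      c j l - Complex.log (P i - Q l) + n * (2 * Real.pi * Complex.I) := by
    by_cases hlj : l = j
    · exact ⟨0, fun h => absurd hlj h⟩
    obtain ⟨n, hn⟩ := Complex.exp_eq_exp_iff_exists_int.1
      (show Complex.exp (logIncrement (fun t => γ i j t - Q l)) =
        Complex.exp (c j l - Complex.log (P i - Q l)) by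
        rw [exp_logIncrement (by fun_prop) (hQγ l i j hlj), Complex.exp_sub,
          Complex.exp_log (hPQ i l), hc j l (Ne.symm hlj)]
        simp)
    exact ⟨n, fun _ => hn⟩
  choose m hm using hm
  choose n hn using hn
  -- In the square relation the logarithms of `P i - Q j` cancel; what is left of the others is the
  -- sign `±π i` from each of the pairs `i, i'` and `j, j'`.
  have key (i i' j j' : Fin 3) (hi : i ≠ i') (hj : j ≠ j') :
      (b i' i - b i i') + (c j' j - c j j') =
        (2 * Real.pi * Complex.I) * (m i i' j' + n j' i j - m i' i j - n j i' j') := by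
    have := logIncrement_add_logIncrement (γ i j).continuous (γ i' j').continuous
      (hγ i i' j j' hi hj)
    simp only [Path.source, Path.target] at this
    rw [hm _ _ _ hi.symm, hm _ _ _ hi, hn _ _ _ hj, hn _ _ _ hj.symm] at this
    linear_combination this
  have h2 : (2 * Real.pi * Complex.I : ℂ) ≠ 0 := Complex.two_pi_I_ne_zero
  refine parity_contradiction m n (fun i i' j j' hi hj => ?_) (fun i i' j j' hi hj => ?_)
  · have := key i i' j j' hi.ne hj.ne
    rw [hb' _ _ hi, hc' _ _ hj] at this
    have h3 : (1 : ℂ) = m i i' j' + n j' i j - m i' i j - n j i' j' :=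
      mul_left_cancel₀ h2 (by linear_combination this)
    exact_mod_cast h3
  · have := key i i' j j' hi.ne hj.ne'
    rw [hb' _ _ hi, ← neg_sub, hc' _ _ hj] at this
    have h3 : (0 : ℂ) = m i i' j' + n j' i j - m i' i j - n j i' j' :=
      mul_left_cancel₀ h2 (by linear_combination this)
    exact_mod_cast h3

/-- `not_drawing_K33_complex` with the edges given as sets inside which the vertices are joined. -/
theorem not_drawing_K33 (P Q : Fin 3 → Plane) (K : Fin 3 → Fin 3 → Set Plane)
    (hK : ∀ i j, JoinedIn (K i j) (P i) (Q j))
    (hdisj : ∀ i i' j j', i ≠ i' → j ≠ j' → Disjoint (K i j) (K i' j')) : False := by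
  let e := Complex.orthonormalBasisOneI.repr.symm
  refine not_drawing_K33_complex (fun i => e (P i)) (fun j => e (Q j))
    (fun i j => (hK i j).somePath.map e.continuous) fun i i' j j' hi hj s t h => ?_
  have h' : (hK i j).somePath s = (hK i' j').somePath t := e.injective h
  exact Set.disjoint_left.1 (hdisj i i' j j' hi hj) ((hK i j).somePath_mem s)
    (h' ▸ (hK i' j').somePath_mem t)

end Topology

/-! ### Drawings of walks and faces -/

namespace PlanarEmbedding

open scoped unitInterval

variable {V : Type*} {G : SimpleGraph V} (D : PlanarEmbedding G)

/-- The point set of the drawing of a walk. -/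
def walkDrawing {a b : V} (p : G.Walk a b) : Set Plane :=
  D.pos '' {v | v ∈ p.support} ∪ ⋃ e ∈ {e | e ∈ p.edges}, D.arc e

variable {D}

theorem walkDrawing_subset_drawing {a b : V} (p : G.Walk a b) : D.walkDrawing p ⊆ D.drawing :=
  Set.union_subset_union (Set.image_subset_range _ _)
    (Set.biUnion_subset_biUnion_left fun _ he => p.edges_subset_edgeSet he)

theorem isCompact_arc {e : Sym2 V} (he : e ∈ G.edgeSet) : IsCompact (D.arc e) := by
  induction e using Sym2.ind with
  | h x y =>
    obtain ⟨γ, -, hγ⟩ := D.isSimpleArc x y he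
    exact hγ ▸ isCompact_range γ.continuous

theorem isClosed_walkDrawing {a b : V} (p : G.Walk a b) : IsClosed (D.walkDrawing p) :=
  (((List.finite_toSet p.support).image _).isClosed).union
    ((List.finite_toSet p.edges).isClosed_biUnion fun _ he =>
      (isCompact_arc (p.edges_subset_edgeSet he)).isClosed)

theorem isClosed_drawing [Finite V] : IsClosed D.drawing :=
  (Set.finite_range _).isClosed.union
    ((Set.toFinite _).isClosed_biUnion fun _ he => (isCompact_arc he).isClosed)

theorem joinedIn_walkDrawing {a b : V} (p : G.Walk a b) :
    JoinedIn (D.walkDrawing p) (D.pos a) (D.pos b) := by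
  induction p with
  | nil => exact JoinedIn.refl (Or.inl ⟨_, by simp, rfl⟩)
  | @cons x y b h p ih =>
    have h1 : JoinedIn (D.arc s(x, y)) (D.pos x) (D.pos y) := by
      obtain ⟨γ, -, hγ⟩ := D.isSimpleArc x y h
      exact ⟨γ, fun t => hγ ▸ Set.mem_range_self t⟩
    refine (h1.mono ?_).trans (ih.mono ?_)
    · exact Set.subset_union_of_subset_right
        (Set.subset_biUnion_of_mem (u := D.arc) (by simp)) _
    · refine Set.union_subset_union (Set.image_mono fun w hw => ?_)
        (Set.biUnion_subset_biUnion_left fun e he => ?_)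
      · exact List.mem_cons_of_mem _ hw
      · exact List.mem_cons_of_mem _ he

theorem pos_mem_walkDrawing {a b w : V} {p : G.Walk a b} :
    D.pos w ∈ D.walkDrawing p ↔ w ∈ p.support := by
  refine ⟨?_, fun h => Or.inl ⟨w, h, rfl⟩⟩
  rintro (⟨w', hw', h⟩ | h)
  · exact D.pos_injective h ▸ hw'
  · obtain ⟨e, he, hw⟩ := Set.mem_iUnion₂.1 h
    exact p.mem_support_of_mem_edges he
      (D.mem_of_pos_mem_arc e (p.edges_subset_edgeSet he) w hw)

/-- An arc meets the drawing of a walk not using it only in common vertices. -/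
theorem exists_eq_pos_of_mem_arc_of_mem_walkDrawing {a b : V} {p : G.Walk a b} {e : Sym2 V}
    (he : e ∈ G.edgeSet) (hep : e ∉ p.edges) {x : Plane} (hx : x ∈ D.arc e)
    (hxp : x ∈ D.walkDrawing p) : ∃ w ∈ e, w ∈ p.support ∧ x = D.pos w := by
  rcases hxp with ⟨w, hw, rfl⟩ | h
  · exact ⟨w, D.mem_of_pos_mem_arc e he w hx, hw, rfl⟩
  · obtain ⟨e', he', hx'⟩ := Set.mem_iUnion₂.1 h
    obtain ⟨w, hw, hw', rfl⟩ := D.arc_inter e he e' (p.edges_subset_edgeSet he')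
      (fun h => hep (h ▸ he')) x ⟨hx, hx'⟩
    exact ⟨w, hw, p.mem_support_of_mem_edges he' hw', rfl⟩

theorem disjoint_walkDrawing {a b c d : V} {p : G.Walk a b} {q : G.Walk c d}
    (h : p.support.Disjoint q.support) : Disjoint (D.walkDrawing p) (D.walkDrawing q) := by
  rw [Set.disjoint_left]
  rintro x (⟨w, hw, rfl⟩ | hx) hxq
  · exact h hw (pos_mem_walkDrawing.1 hxq)
  · obtain ⟨e, he, hx⟩ := Set.mem_iUnion₂.1 hx
    have heq : e ∉ q.edges := fun heq => by
      induction e using Sym2.ind with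
      | h y z => exact h (p.fst_mem_support_of_mem_edges he) (q.fst_mem_support_of_mem_edges heq)
    obtain ⟨w, hw, hwq, -⟩ := exists_eq_pos_of_mem_arc_of_mem_walkDrawing
      (p.edges_subset_edgeSet he) heq hx hxq
    exact h (p.mem_support_of_mem_edges he hw) hwq

/-- An arc can be split at an interior point `m` into two closed halves, each avoiding the other
end. -/
theorem exists_half_arcs (D : PlanarEmbedding G) {x z : V} (hxz : G.Adj x z) :
    ∃ (m : Plane) (H H' : Set Plane), (∀ w, m ≠ D.pos w) ∧
      JoinedIn H (D.pos x) m ∧ JoinedIn H' (D.pos z) m ∧ IsClosed H ∧ IsClosed H' ∧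
      H ⊆ D.arc s(x, z) ∧ H' ⊆ D.arc s(x, z) ∧ D.pos z ∉ H ∧ D.pos x ∉ H' := by
  obtain ⟨γ, hinj, hγ⟩ := D.isSimpleArc x z hxz
  have hmem (t : ℝ) : γ.extend t ∈ D.arc s(x, z) :=
    hγ ▸ Set.mem_range_self (Set.projIcc 0 1 zero_le_one t)
  have hne {s t : ℝ} (hs : s ∈ I) (ht : t ∈ I) (hst : s ≠ t) : γ.extend s ≠ γ.extend t := by
    rw [γ.extend_apply hs, γ.extend_apply ht]
    exact fun h => hst (congrArg Subtype.val (hinj h))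
  have h0 := γ.extend_zero
  have h1 := γ.extend_one
  refine ⟨γ.extend (1 / 2), (fun t => γ.extend (t / 2)) '' I,
    (fun t => γ.extend (1 - t / 2)) '' I, fun w hw => ?_,
    JoinedIn.ofLine (by fun_prop) (by simp) rfl subset_rfl,
    JoinedIn.ofLine (by fun_prop) (by simp) (by norm_num) subset_rfl,
    (isCompact_Icc.image (by fun_prop)).isClosed, (isCompact_Icc.image (by fun_prop)).isClosed,
    Set.image_subset_iff.2 fun t _ => hmem _, Set.image_subset_iff.2 fun t _ => hmem _, ?_, ?_⟩
  · have hwe : w ∈ s(x, z) := D.mem_of_pos_mem_arc _ hxz w (hw ▸ hmem _)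
    rcases Sym2.mem_iff.1 hwe with rfl | rfl
    · exact hne (by norm_num) (by norm_num) (by norm_num) (hw.trans h0.symm)
    · exact hne (by norm_num) (by norm_num) (by norm_num) (hw.trans h1.symm)
  · rintro ⟨t, ⟨ht0, ht1⟩, h⟩
    exact hne ⟨by linarith, by linarith⟩ (by norm_num) (by linarith) (h.trans h1.symm)
  · rintro ⟨t, ⟨ht0, ht1⟩, h⟩
    exact hne ⟨by linarith, by linarith⟩ (by norm_num) (by linarith) (h.trans h0.symm)

theorem IsFace.isOpen [Finite V] {F : Set Plane} (hF : D.IsFace F) : IsOpen F := by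
  obtain ⟨x, -, rfl⟩ := hF
  exact isClosed_drawing.isOpen_compl.connectedComponentIn

theorem IsFace.isPathConnected [Finite V] {F : Set Plane} (hF : D.IsFace F) :
    IsPathConnected F := by
  refine hF.isOpen.isConnected_iff_isPathConnected.1 ?_
  obtain ⟨x, hx, rfl⟩ := hF
  exact isConnected_connectedComponentIn_iff.2 hx

theorem IsFace.disjoint_drawing {F : Set Plane} (hF : D.IsFace F) : Disjoint F D.drawing := by
  obtain ⟨x, -, rfl⟩ := hF
  exact Set.disjoint_left.2 fun y hy => connectedComponentIn_subset _ _ hy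

/-- The boundary of a face does not contain three edges that join a connected piece of the graph
around `u` to a disjoint connected piece around `v`. Otherwise `K₃,₃` could be drawn: on one side
`u`, `v` and a point of the face, on the other side the midpoints of the three edges. -/
theorem IsFace.not_three_connecting_edges [Finite V] {F : Set Plane} (hF : D.IsFace F) {u v : V}
    (x z : Fin 3 → V) (hadj : ∀ j, G.Adj (x j) (z j))
    (hinj : Function.Injective fun j => s(x j, z j))
    (hfr : ∀ j, D.arc s(x j, z j) ⊆ frontier F)
    (p : ∀ j, G.Walk u (x j)) (q : ∀ j, G.Walk v (z j))
    (hpq : ∀ i j, (p i).support.Disjoint (q j).support) : False := by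
  choose m H H' hm hH hH' hHc hHc' hHa hHa' hzH hxH' using fun j => D.exists_half_arcs (hadj j)
  have he (j) : s(x j, z j) ∈ G.edgeSet := hadj j
  have hma (j) : m j ∈ D.arc s(x j, z j) := hHa j (hH j).target_mem
  have hxq (i j) : x i ∉ (q j).support := hpq i j (p i).end_mem_support
  have hzp (i j) : z i ∉ (p j).support := fun h => hpq j i h (q i).end_mem_support
  have hep (i j) : s(x i, z i) ∉ (p j).edges := fun h =>
    hzp i j ((p j).snd_mem_support_of_mem_edges h)
  have heq (i j) : s(x i, z i) ∉ (q j).edges := fun h =>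
    hxq i j ((q j).fst_mem_support_of_mem_edges h)
  -- `A j` and `B j` are the edges of `K₃,₃` from `u` and from `v` to the midpoint `m j`.
  let A : Fin 3 → Set Plane := fun j => D.walkDrawing (p j) ∪ H j
  let B : Fin 3 → Set Plane := fun j => D.walkDrawing (q j) ∪ H' j
  have hAc (j) : IsClosed (A j) := (isClosed_walkDrawing _).union (hHc j)
  have hBc (j) : IsClosed (B j) := (isClosed_walkDrawing _).union (hHc' j)
  have hsub (j) : D.arc s(x j, z j) ⊆ D.drawing :=
    Set.subset_union_of_subset_right (Set.subset_biUnion_of_mem (u := D.arc) (he j)) _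
  have hAd (j) : A j ⊆ D.drawing :=
    Set.union_subset (walkDrawing_subset_drawing _) ((hHa j).trans (hsub j))
  have hBd (j) : B j ⊆ D.drawing :=
    Set.union_subset (walkDrawing_subset_drawing _) ((hHa' j).trans (hsub j))
  have hmA (i j) (hij : i ≠ j) : m i ∉ A j := by
    rintro (h | h)
    · obtain ⟨w, -, -, hw⟩ :=
        exists_eq_pos_of_mem_arc_of_mem_walkDrawing (he i) (hep i j) (hma i) h
      exact hm i w hw
    · obtain ⟨w, -, -, hw⟩ := D.arc_inter _ (he i) _ (he j) (hinj.ne hij) _ ⟨hma i, hHa j h⟩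
      exact hm i w hw
  have hmB (i j) (hij : i ≠ j) : m i ∉ B j := by
    rintro (h | h)
    · obtain ⟨w, -, -, hw⟩ :=
        exists_eq_pos_of_mem_arc_of_mem_walkDrawing (he i) (heq i j) (hma i) h
      exact hm i w hw
    · obtain ⟨w, -, -, hw⟩ := D.arc_inter _ (he i) _ (he j) (hinj.ne hij) _ ⟨hma i, hHa' j h⟩
      exact hm i w hw
  have hAB (i j) (hij : i ≠ j) : Disjoint (A i) (B j) := by
    rw [Set.disjoint_left]
    rintro y (hy | hy) (hy' | hy')
    · exact Set.disjoint_left.1 (disjoint_walkDrawing (hpq i j)) hy hy'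
    · obtain ⟨w, hw, hwp, rfl⟩ :=
        exists_eq_pos_of_mem_arc_of_mem_walkDrawing (he j) (hep j i) (hHa' j hy') hy
      rcases Sym2.mem_iff.1 hw with rfl | rfl
      · exact hxH' j hy'
      · exact hzp j i hwp
    · obtain ⟨w, hw, hwq, rfl⟩ :=
        exists_eq_pos_of_mem_arc_of_mem_walkDrawing (he i) (heq i j) (hHa i hy) hy'
      rcases Sym2.mem_iff.1 hw with rfl | rfl
      · exact hxq i j hwq
      · exact hzH i hy
    · obtain ⟨w, hw, hw', rfl⟩ :=
        D.arc_inter _ (he i) _ (he j) (hinj.ne hij) _ ⟨hHa i hy, hHa' j hy'⟩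
      rcases Sym2.mem_iff.1 hw with rfl | rfl
      · rcases Sym2.mem_iff.1 hw' with h | h
        · exact hxH' j (h ▸ hy')
        · exact hzp j i (h ▸ (p i).end_mem_support)
      · exact hzH i hy
  -- The edges from the face to `m i` leave the face only within a ball about `m i` that is small
  -- enough to miss `A j` and `B j` for `j ≠ i`.
  have hball (i) : ∃ ε > 0, ∀ j, i ≠ j →
      Disjoint (Metric.ball (m i) ε) (A j) ∧ Disjoint (Metric.ball (m i) ε) (B j) := by
    have hclosed : IsClosed (⋃ j ∈ {j | i ≠ j}, (A j ∪ B j)) :=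
      (Set.toFinite _).isClosed_biUnion fun j _ => (hAc j).union (hBc j)
    have hmem : m i ∈ (⋃ j ∈ {j | i ≠ j}, (A j ∪ B j))ᶜ := by
      intro h
      obtain ⟨j, hij, h | h⟩ := Set.mem_iUnion₂.1 h
      · exact hmA i j hij h
      · exact hmB i j hij h
    obtain ⟨ε, hε, hsub⟩ := Metric.isOpen_iff.1 hclosed.isOpen_compl _ hmem
    refine ⟨ε, hε, fun j hij => ?_⟩
    rw [← Set.disjoint_union_right]
    exact (Set.disjoint_compl_left_iff_subset.2
      (Set.subset_biUnion_of_mem (u := fun j => A j ∪ B j) hij)).mono_left hsub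
  choose ε hε hball using hball
  obtain ⟨f, hf, hfF⟩ := hF.isPathConnected
  let C : Fin 3 → Set Plane := fun j => F ∪ Metric.ball (m j) (ε j)
  have hC (j) : JoinedIn (C j) f (m j) := by
    obtain ⟨y, hy, hyF⟩ := Metric.mem_closure_iff.1 (hfr j (hma j)).1 (ε j) (hε j)
    have hyb : y ∈ Metric.ball (m j) (ε j) := by rwa [Metric.mem_ball, dist_comm]
    exact ((hfF hy).mono Set.subset_union_left).trans
      ((((convex_ball (m j) (ε j)).isPathConnected ⟨y, hyb⟩).joinedIn y hyb (m j)
        (Metric.mem_ball_self (hε j))).mono Set.subset_union_right)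
  have hCA (i j) (hij : i ≠ j) : Disjoint (C i) (A j) :=
    (hF.disjoint_drawing.mono_right (hAd j)).union_left (hball i j hij).1
  have hCB (i j) (hij : i ≠ j) : Disjoint (C i) (B j) :=
    (hF.disjoint_drawing.mono_right (hBd j)).union_left (hball i j hij).2
  refine not_drawing_K33 ![f, D.pos u, D.pos v] m ![C, A, B] (fun i j => ?_)
    fun i i' j j' hi hj => ?_
  · fin_cases i
    · exact hC j
    · exact ((joinedIn_walkDrawing (p j)).mono Set.subset_union_left).trans
        ((hH j).mono Set.subset_union_right)
    · exact ((joinedIn_walkDrawing (q j)).mono Set.subset_union_left).trans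
        ((hH' j).mono Set.subset_union_right)
  · fin_cases i <;> fin_cases i'
    · exact absurd rfl hi
    · exact hCA j j' hj
    · exact hCB j j' hj
    · exact (hCA j' j hj.symm).symm
    · exact absurd rfl hi
    · exact hAB j j' hj
    · exact (hCB j' j hj.symm).symm
    · exact (hAB j' j hj.symm).symm
    · exact absurd rfl hi

end PlanarEmbedding

/-! ### Weighted distance -/

section Distance

variable {V : Type*} {G : SimpleGraph V} {ω : Sym2 V → ℝ≥0∞}

theorem walkWeight_append {a b c : V} (p : G.Walk a b) (q : G.Walk b c) :
    walkWeight ω (p.append q) = walkWeight ω p + walkWeight ω q := by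
  simp [walkWeight, SimpleGraph.Walk.edges_append]

theorem walkWeight_reverse {a b : V} (p : G.Walk a b) :
    walkWeight ω p.reverse = walkWeight ω p := by
  simp [walkWeight, SimpleGraph.Walk.edges_reverse, List.sum_reverse]

theorem weightedDist_le_walkWeight {a b : V} (p : G.Walk a b) :
    weightedDist G ω a b ≤ walkWeight ω p :=
  iInf_le _ p

/-- Only the finitely many paths matter for the distance, so it is attained. -/
theorem exists_walkWeight_eq_weightedDist [Finite V] {a b : V} (h : weightedDist G ω a b ≠ ∞) :
    ∃ p : G.Walk a b, walkWeight ω p = weightedDist G ω a b := by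
  classical
  have := Fintype.ofFinite V
  have hne : Nonempty (G.Walk a b) := by
    by_contra hne
    rw [not_nonempty_iff] at hne
    exact h (iInf_of_empty _)
  have : Nonempty (G.Path a b) := hne.map fun p => ⟨p.bypass, p.bypass_isPath⟩
  obtain ⟨p, hp⟩ := Finite.exists_min fun p : G.Path a b => walkWeight ω p.1
  refine ⟨p.1, (le_iInf fun q => (hp ⟨q.bypass, q.bypass_isPath⟩).trans ?_).antisymm
    (weightedDist_le_walkWeight _)⟩
  exact (q.edges_bypass_sublist_edges.map ω).sum_le_sum (by simp)

theorem weightedDist_le_walkWeight_add [Finite V] {a b c : V} (p : G.Walk a b) :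
    weightedDist G ω a c ≤ walkWeight ω p + weightedDist G ω b c := by
  by_cases h : weightedDist G ω b c = ∞
  · simp [h]
  · obtain ⟨q, hq⟩ := exists_walkWeight_eq_weightedDist h
    rw [← hq, ← walkWeight_append]
    exact weightedDist_le_walkWeight _

theorem exists_walk_walkWeight_ne_top {a b x y : V} (p : G.Walk a b) (hp : walkWeight ω p ≠ ∞)
    (hx : x ∈ p.support) (hy : y ∈ p.support) : ∃ q : G.Walk x y, walkWeight ω q ≠ ∞ := by
  classical
  have hle {w : V} (hw : w ∈ p.support) : walkWeight ω (p.takeUntil w hw) ≠ ∞ := by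
    rw [← p.take_spec hw, walkWeight_append] at hp
    exact (ENNReal.add_ne_top.1 hp).1
  refine ⟨(p.takeUntil x hx).reverse.append (p.takeUntil y hy), ?_⟩
  rw [walkWeight_append, walkWeight_reverse]
  exact ENNReal.add_ne_top.2 ⟨hle hx, hle hy⟩

end Distance

/-! ### Voronoi cells -/

section Nearest

variable {V : Type*} [Finite V] [LinearOrder V] {G : SimpleGraph V} {ω : Sym2 V → ℝ≥0∞}
  {S : Finset V} {hS : S.Nonempty}

/-- A shortest walk from `x` to its nearest vertex of `S` stays in the Voronoi cell of that
vertex. -/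
theorem exists_walk_nearest_eq {x : V} (hx : weightedDist G ω x (nearest G ω S hS x) ≠ ∞) :
    ∃ q : G.Walk (nearest G ω S hS x) x,
      ∀ w ∈ q.support, nearest G ω S hS w = nearest G ω S hS x := by
  classical
  obtain ⟨q, hq⟩ := exists_walkWeight_eq_weightedDist hx
  refine ⟨q.reverse, fun w hw => ?_⟩
  rw [SimpleGraph.Walk.support_reverse, List.mem_reverse] at hw
  by_contra hne
  obtain ⟨hsS, hs⟩ := nearest_spec G ω S hS x
  obtain ⟨htS, ht⟩ := nearest_spec G ω S hS w
  generalize nearest G ω S hS w = t at *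
  generalize nearest G ω S hS x = s at *
  have hsplit : walkWeight ω (q.takeUntil w hw) + walkWeight ω (q.dropUntil w hw) =
      weightedDist G ω x s := by
    rw [← walkWeight_append, q.take_spec hw, hq]
  have hfin : walkWeight ω (q.takeUntil w hw) ≠ ∞ :=
    (ENNReal.add_ne_top.1 (hsplit ▸ hx)).1
  have htri := weightedDist_le_walkWeight_add (ω := ω) (c := t) (q.takeUntil w hw)
  have hdrop := weightedDist_le_walkWeight (ω := ω) (q.dropUntil w hw)
  have hxs : weightedDist G ω x s ≤ weightedDist G ω x t := by
    rcases hs t htS hne with h | h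
    · exact h.le
    · exact h.1.le
  rcases ht s hsS (Ne.symm hne) with h | ⟨h, hts⟩
  · refine (hxs.trans htri).not_gt ?_
    rw [← hsplit]
    exact ENNReal.add_lt_add_left hfin (h.trans_le hdrop)
  · have hxt : weightedDist G ω x t ≤ weightedDist G ω x s := by
      rw [← hsplit]
      exact htri.trans (by gcongr; exact h.le.trans hdrop)
    rcases hs t htS hne with h' | ⟨-, hst⟩
    · exact h'.not_ge hxt
    · exact lt_asymm hst hts

/-- If `x` is infinitely far from `S`, then so is every vertex at finite distance from `x`, and both
have the least element of `S` as nearest vertex. -/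
theorem weightedDist_nearest_ne_top {x y : V} (q : G.Walk x y) (hq : walkWeight ω q ≠ ∞)
    (hne : nearest G ω S hS x ≠ nearest G ω S hS y) :
    weightedDist G ω x (nearest G ω S hS x) ≠ ∞ := by
  intro htop
  obtain ⟨hsS, hs⟩ := nearest_spec G ω S hS x
  obtain ⟨htS, ht⟩ := nearest_spec G ω S hS y
  generalize nearest G ω S hS x = s at *
  generalize nearest G ω S hS y = t at *
  rcases hs t htS hne.symm with h | ⟨h, hst⟩
  · exact not_top_lt (htop ▸ h)
  · have hyt : weightedDist G ω y t = ∞ := by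
      by_contra hy
      have := weightedDist_le_walkWeight_add (ω := ω) (c := t) q
      rw [← h, htop, top_le_iff] at this
      exact ENNReal.add_ne_top.2 ⟨hq, hy⟩ this
    rcases ht s hsS hne with h' | ⟨-, hts⟩
    · exact not_top_lt (hyt ▸ h')
    · exact lt_asymm hst hts

end Nearest

/-! ### Edges between two cells along a walk -/

section Walks

theorem Nat.exists_last_of_not {P : ℕ → Prop} {i j : ℕ} (hij : i ≤ j) (hi : P i) (hj : ¬P j) :
    ∃ k, i ≤ k ∧ k < j ∧ P k ∧ ∀ l, k < l → l ≤ j → ¬P l := by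
  classical
  refine ⟨Nat.findGreatest P j, Nat.le_findGreatest hij hi, ?_, Nat.findGreatest_spec hij hi,
    fun l hl hlj => Nat.findGreatest_is_greatest hl hlj⟩
  exact (Nat.findGreatest_le j).lt_of_ne fun h => hj (h ▸ Nat.findGreatest_spec hij hi)

theorem Nat.exists_first_of_not {P : ℕ → Prop} {i j : ℕ} (hij : i ≤ j) (hi : ¬P i) (hj : P j) :
    ∃ k, i ≤ k ∧ k < j ∧ P (k + 1) ∧ ∀ l, i ≤ l → l ≤ k → ¬P l := by
  classical
  have hex : ∃ k, P (i + k + 1) := by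
    have : i ≠ j := fun h => hi (h ▸ hj)
    exact ⟨j - i - 1, by rwa [show i + (j - i - 1) + 1 = j by omega]⟩
  refine ⟨i + Nat.find hex, by omega, ?_, Nat.find_spec hex, fun l hl hlk hPl => ?_⟩
  · by_contra hlt
    have : i ≠ j := fun h => hi (h ▸ hj)
    refine Nat.find_min hex (m := j - i - 1) (by omega) ?_
    rwa [show i + (j - i - 1) + 1 = j by omega]
  · obtain rfl | hl := hl.eq_or_lt
    · exact hi hPl
    · refine Nat.find_min hex (m := l - i - 1) (by omega) ?_
      rwa [show i + (l - i - 1) + 1 = l by omega]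

variable {V : Type*} {G : SimpleGraph V}

theorem SimpleGraph.Walk.exists_walk_getVert {a b : V} (p : G.Walk a b) {i j : ℕ} (hij : i ≤ j)
    (hj : j ≤ p.length) :
    ∃ r : G.Walk (p.getVert i) (p.getVert j),
      ∀ w ∈ r.support, ∃ k, i ≤ k ∧ k ≤ j ∧ w = p.getVert k := by
  induction j, hij using Nat.le_induction with
  | base => exact ⟨.nil, fun w hw => ⟨i, le_rfl, le_rfl, by simpa using hw⟩⟩
  | succ j hij ih =>
    obtain ⟨r, hr⟩ := ih (by omega)
    refine ⟨r.concat (p.adj_getVert_succ hj), fun w hw => ?_⟩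
    rw [SimpleGraph.Walk.support_concat, List.mem_append,
      List.mem_singleton] at hw
    rcases hw with hw | rfl
    · obtain ⟨k, hik, hkj, rfl⟩ := hr w hw
      exact ⟨k, hik, by omega, rfl⟩
    · exact ⟨j + 1, by omega, le_rfl, rfl⟩

theorem SimpleGraph.Walk.mk_getVert_mem_edges {a b : V} (p : G.Walk a b) {k : ℕ}
    (hk : k < p.length) : s(p.getVert k, p.getVert (k + 1)) ∈ p.edges :=
  p.adj_toSubgraph_iff_mem_edges.1 (p.toSubgraph_adj_getVert hk)

theorem SimpleGraph.Walk.IsPath.eq_of_mk_getVert_eq {a b : V} {p : G.Walk a b} (hp : p.IsPath)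
    {k l : ℕ} (hk : k < p.length) (hl : l < p.length)
    (h : s(p.getVert k, p.getVert (k + 1)) = s(p.getVert l, p.getVert (l + 1))) : k = l := by
  rcases Sym2.eq_iff.1 h with ⟨h1, -⟩ | ⟨h1, h2⟩
  · exact hp.getVert_injOn hk.le hl.le h1
  · have := hp.getVert_injOn (show k ≤ p.length from hk.le) (show l + 1 ≤ p.length from hl) h1
    have := hp.getVert_injOn (show k + 1 ≤ p.length from hk) (show l ≤ p.length from hl.le) h2
    omega

/-- Between a vertex labelled `u` and a vertex labelled `v` of a walk, in either order, some edge
`xz` of the walk leads from the label `u` to a vertex that reaches `v` without meeting the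
label `u`. -/
theorem SimpleGraph.Walk.exists_connecting_edge {a b : V} (p : G.Walk a b) (N : V → V) {u v : V}
    (huv : u ≠ v)
    (hu : ∀ x ∈ p.support, N x = u → ∃ r : G.Walk u x, ∀ w ∈ r.support, N w = u)
    (hv : ∀ x ∈ p.support, N x = v → ∃ r : G.Walk v x, ∀ w ∈ r.support, N w = v)
    {i j : ℕ} (hij : i ≤ j) (hj : j ≤ p.length)
    (h : N (p.getVert i) = u ∧ N (p.getVert j) = v ∨ N (p.getVert i) = v ∧ N (p.getVert j) = u) :
    ∃ k x z, i ≤ k ∧ k < j ∧ s(x, z) = s(p.getVert k, p.getVert (k + 1)) ∧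
      (∃ r : G.Walk u x, ∀ w ∈ r.support, N w = u) ∧
      (∃ r : G.Walk v z, ∀ w ∈ r.support, N w ≠ u) := by
  rcases h with ⟨hi', hj'⟩ | ⟨hi', hj'⟩
  · obtain ⟨k, hik, hkj, hk, hlast⟩ := Nat.exists_last_of_not
      (P := fun l => N (p.getVert l) = u) hij hi' (by rw [hj']; exact huv.symm)
    obtain ⟨r, hr⟩ := hv _ (p.getVert_mem_support j) hj'
    obtain ⟨r', hr'⟩ := p.exists_walk_getVert (i := k + 1) hkj hj
    refine ⟨k, _, _, hik, hkj, rfl, hu _ (p.getVert_mem_support k) hk,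
      r.append r'.reverse, fun w hw => ?_⟩
    rw [SimpleGraph.Walk.mem_support_append_iff, SimpleGraph.Walk.support_reverse,
      List.mem_reverse] at hw
    rcases hw with hw | hw
    · rw [hr w hw]; exact huv.symm
    · obtain ⟨l, hkl, hlj, rfl⟩ := hr' w hw
      exact hlast l hkl hlj
  · obtain ⟨k, hik, hkj, hk, hfirst⟩ := Nat.exists_first_of_not
      (P := fun l => N (p.getVert l) = u) hij (by rw [hi']; exact huv.symm) hj'
    obtain ⟨r, hr⟩ := hv _ (p.getVert_mem_support i) hi'
    obtain ⟨r', hr'⟩ := p.exists_walk_getVert hik (by omega)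
    refine ⟨k, _, _, hik, hkj, Sym2.eq_swap, hu _ (p.getVert_mem_support (k + 1)) hk,
      r.append r', fun w hw => ?_⟩
    rw [SimpleGraph.Walk.mem_support_append_iff] at hw
    rcases hw with hw | hw
    · rw [hr w hw]; exact huv.symm
    · obtain ⟨l, hil, hlk, rfl⟩ := hr' w hw
      exact hfirst l hil hlk

end Walks

/-! ### Alternation of labels -/

/-- Along a path of finite weight on the boundary of a face, two labels do not alternate
`u, v, u, v`: each of the three steps between consecutive positions contributes one edge to
`IsFace.not_three_connecting_edges`. -/
theorem PlanarEmbedding.IsFace.nearest_not_alternating {V : Type*} [Finite V] [LinearOrder V]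
    {G : SimpleGraph V} {ω : Sym2 V → ℝ≥0∞} {D : PlanarEmbedding G} {F : Set Plane}
    (hF : D.IsFace F) {S : Finset V} {hS : S.Nonempty} {a b : V} {p : G.Walk a b}
    (hp : p.IsPath) (hfin : walkWeight ω p ≠ ∞) (hpF : D.WalkOnBoundary p F)
    {idx : Fin 4 → ℕ} (hidx : StrictMono idx) (hlen : idx 3 ≤ p.length) {u v : V} (huv : u ≠ v)
    (hlab : ∀ j, nearest G ω S hS (p.getVert (idx j)) = if Even j.val then u else v) : False := by
  -- As two different labels occur on the path, no vertex of the path is infinitely far from its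
  -- nearest vertex, and the cells of `u` and `v` are connected.
  have hcell {s t : V} (hst : s ≠ t) {y : V} (hy : y ∈ p.support)
      (hyt : nearest G ω S hS y = t) (x : V) (hx : x ∈ p.support)
      (hxs : nearest G ω S hS x = s) :
      ∃ r : G.Walk s x, ∀ w ∈ r.support, nearest G ω S hS w = s := by
    subst hxs hyt
    obtain ⟨q, hq⟩ := exists_walk_walkWeight_ne_top p hfin hx hy
    exact exists_walk_nearest_eq (weightedDist_nearest_ne_top q hq hst)
  have hu := hcell huv (p.getVert_mem_support (idx 1)) (by simpa using hlab 1)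
  have hv := hcell huv.symm (p.getVert_mem_support (idx 0)) (by simpa using hlab 0)
  have hstep (j : Fin 3) := p.exists_connecting_edge (nearest G ω S hS) huv hu hv
    (hidx (Fin.castSucc_lt_succ (i := j))).le
    ((hidx.monotone (Fin.le_last j.succ)).trans hlen) (by
      have h1 := hlab j.castSucc
      have h2 := hlab j.succ
      rw [h1, h2]
      fin_cases j <;> simp [show ¬ Even 3 by decide])
  choose k x z hk hk' he hx hz using hstep
  choose r hr using hx
  choose q hq using hz
  have hkl (j) : k j < p.length :=
    (hk' j).trans_le ((hidx.monotone (Fin.le_last j.succ)).trans hlen)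
  have hmono : StrictMono k := fun i j hij =>
    (hk' i).trans_le ((hidx.monotone (Fin.succ_le_castSucc_iff.2 hij)).trans (hk j))
  have hmem (j) : s(x j, z j) ∈ p.edges := he j ▸ p.mk_getVert_mem_edges (hkl j)
  refine hF.not_three_connecting_edges x z (fun j => p.adj_of_mem_edges (hmem j))
    (fun i j hij => hmono.injective (hp.eq_of_mk_getVert_eq (hkl i) (hkl j) ?_))
    (fun j => hpF.2 _ (hmem j)) r q (fun i j w hw hw' => hq j w hw' (hr i w hw))
  rw [← he, ← he]
  exact hij

theorem mainTheorem4 {V : Type*} [Finite V] [LinearOrder V] (G : SimpleGraph V)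
    (ω : Sym2 V → ℝ≥0∞) (D : PlanarEmbedding G) (F : Set Plane) (hF : D.IsFace F)
    (S : Finset V) (hS : S.Nonempty) (a b : V) (p : G.Walk a b)
    (hp : IsShortestPath ω p) (hfin : walkWeight ω p < ∞) (hpF : D.WalkOnBoundary p F) :
    IsDavenportSchinzel S S.card 2 (contraction (labelSequence G ω S hS p.support)) := by
  have hsub : (contraction (labelSequence G ω S hS p.support)).Sublist
      (labelSequence G ω S hS p.support) :=
    List.destutter_sublist _ _
  refine ⟨rfl, fun s hs => ?_, fun i h => ?_, ?_⟩
  · obtain ⟨x, -, rfl⟩ := List.mem_map.1 (hsub.subset hs)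
    exact (nearest_spec G ω S hS x).1
  · exact (List.isChain_destutter (R := fun x y : V => x ≠ y)
      (labelSequence G ω S hS p.support)).getElem i h
  · rintro ⟨idx, u, v, hidx, huv, hlab⟩
    obtain ⟨f, hf⟩ := List.sublist_iff_exists_fin_orderEmbedding_get_eq.1 hsub
    have hlen (i) : (f i : ℕ) ≤ p.length := by
      have := (f i).2
      simp only [labelSequence, List.length_map, SimpleGraph.Walk.length_support] at this
      omega
    refine hF.nearest_not_alternating (S := S) (hS := hS) hp.1 hfin.ne hpF
      (idx := fun j => f (idx j)) (f.strictMono.comp hidx) (hlen _) huv fun j => ?_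
    rw [← hlab j, hf, p.getVert_eq_support_getElem (hlen _)]
    simp [labelSequence]
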